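/- For a standard probability space $(X,\mu)$, let $\operatorname{Aut}_{\mathrm{mp}}(X,\mu)$ be the group of measure preserving automorphisms of $(X,\mu)$, identifying two automorphisms that coincide almost everywhere, with the weak topology (the coarsest topology making $T \mapsto \mu(T^{-1}(A) \mathbin{\triangle} B)$ continuous for all measurable $A,B \subset X$). A Polish group $G$ is called a \emph{centralizer group} if there exists an ergodic probability measure preserving action $\Lambda \curvearrowright (X,\mu)$ of a countable group $\Lambda$ on a standard probability space $(X,\mu)$ such that $G$ is isomorphic, as a topological group, with the centralizer of $\Lambda$ inside $\operatorname{Aut}_{\mathrm{mp}}(X,\mu)$. Let $K$ be a compact (Hausdorff) second countable group with Haar probability measure $\lambda$, and let $\operatorname{Aut} K$ be the group of continuous automorphisms of $K$, with the topology inherited from the group of homeomorphisms of $K$ (uniform convergence). Then $\operatorname{Aut} K$ is a centralizer group (in particular, a Polish group). Moreover, put $(X,\mu) = (K,\lambda)^{\mathbb{N}}$ and let $\Lambda < \operatorname{Aut}_{\mathrm{mp}}(X,\mu)$ be the subgroup generated by the group $S_\infty$ of all permutations of $\mathbb{N}$, acting by permuting the coordinates, and the transformation $\theta$ given by $(\theta(x))_1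 = x_1 x_2$ and $(\theta(x))_n = x_n$ for $n \neq 1$. Then $\beta \mapsto \varphi_\beta$, where $(\varphi_\beta(x))_n = \beta(x_n)$, is an isomorphism of topological groups from $\operatorname{Aut} K$ onto the centralizer of $\Lambda$ inside $\operatorname{Aut}_{\mathrm{mp}}(X,\mu)$. -/

import Mathlib

open MeasureTheory
open scoped symmDiff ENNReal

noncomputable section

universe u

/-! ### Measure preserving automorphisms modulo null sets -/

/-- The group of bimeasurable, measure preserving bijections of `X` (no identification yet). -/
def mpPerm {X : Type u} [MeasurableSpace X] (μ : Measure X) : Subgroup (Equiv.Perm X) where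
  carrier := {e | MeasurePreserving e μ μ ∧ MeasurePreserving e.symm μ μ}
  mul_mem' := fun ha hb => ⟨ha.1.comp hb.1, hb.2.comp ha.2⟩
  one_mem' := ⟨MeasurePreserving.id μ, MeasurePreserving.id μ⟩
  inv_mem' := fun ha => ⟨ha.2, ha.1⟩

/-- The normal subgroup of those transformations that are almost everywhere the identity. -/
def aeTrivial {X : Type u} [MeasurableSpace X] (μ : Measure X) : Subgroup (mpPerm μ) where
  carrier := {e | ∀ᵐ x ∂μ, e.1 x = x}
  mul_mem' := by
    intro a b ha hb
    simp only [Set.mem_ofPred_eq] at *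
    filter_upwards [ha, hb] with x hxa hxb
    simp [hxa, hxb]
  one_mem' := by simp
  inv_mem' := by
    intro a ha
    simp only [Set.mem_ofPred_eq] at *
    filter_upwards [ha] with x hx
    exact (Equiv.symm_apply_eq a.1).2 hx.symm

instance aeTrivial_normal {X : Type u} [MeasurableSpace X] (μ : Measure X) :
    (aeTrivial μ).Normal where
  conj_mem := by
    intro n hn g
    have h : ∀ᵐ x ∂μ, n.1 (g.1.symm x) = g.1.symm x :=
      g.2.2.quasiMeasurePreserving.ae hn
    change ∀ᵐ x ∂μ, (g * n * g⁻¹).1 x = x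
    filter_upwards [h] with x hx
    change g.1 (n.1 (g.1.symm x)) = x
    rw [hx, Equiv.apply_symm_apply]

/-- `Aut_mp(X, μ)`: measure preserving automorphisms of `(X, μ)`, two of them being identified
when they coincide almost everywhere. -/
def AutMP {X : Type u} [MeasurableSpace X] (μ : Measure X) : Type u := mpPerm μ ⧸ aeTrivial μ

instance AutMP.instGroup {X : Type u} [MeasurableSpace X] (μ : Measure X) : Group (AutMP μ) :=
  inferInstanceAs (Group (mpPerm μ ⧸ aeTrivial μ))

/-- The class in `Aut_mp(X, μ)` of a measure preserving isomorphism. -/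
def AutMP.mk {X : Type u} [MeasurableSpace X] {μ : Measure X} (e : X ≃ᵐ X)
    (he : MeasurePreserving e μ μ) : AutMP μ :=
  QuotientGroup.mk (s := aeTrivial μ) ⟨e.toEquiv, he, he.symm e⟩

theorem AutMP.measure_preimage_congr {X : Type u} [MeasurableSpace X] {μ : Measure X}
    (A B : Set X) {a b : mpPerm μ} (h : (QuotientGroup.leftRel (aeTrivial μ)).r a b) :
    μ ((a.1 ⁻¹' A) ∆ B) = μ ((b.1 ⁻¹' A) ∆ B) := by
  have h1 : a⁻¹ * b ∈ aeTrivial μ := QuotientGroup.leftRel_apply.1 h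
  have h2 : ∀ᵐ x ∂μ, a.1.symm (b.1 x) = x := h1
  refine measure_congr ?_
  filter_upwards [h2] with x hx
  have hab : b.1 x = a.1 x := (Equiv.symm_apply_eq a.1).1 hx
  refine propext ?_
  change (x ∈ (a.1 ⁻¹' A) ∆ B) ↔ (x ∈ (b.1 ⁻¹' A) ∆ B)
  simp only [Set.mem_symmDiff, Set.mem_preimage, hab]

/-- The function `T ↦ μ (T⁻¹(A) ∆ B)` on `Aut_mp(X, μ)`. -/
def AutMP.dist {X : Type u} [MeasurableSpace X] {μ : Measure X} (A B : Set X) :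
    AutMP μ → ℝ≥0∞ :=
  Quotient.lift (fun T : mpPerm μ => μ ((T.1 ⁻¹' A) ∆ B))
    (fun _ _ h => AutMP.measure_preimage_congr A B h)

/-- The weak topology on `Aut_mp(X, μ)`, i.e. the coarsest topology for which all the maps
`T ↦ T⁻¹(A)` into the measure algebra with its metric `(A, B) ↦ μ (A ∆ B)` are continuous.
As `μ (T⁻¹(A) ∆ B) = μ (A ∆ T(B))`, the maps `T ↦ T(A)` give the same topology. -/
instance AutMP.instTopologicalSpace {X : Type u} [MeasurableSpace X] (μ : Measure X) :
    TopologicalSpace (AutMP μ) :=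
  ⨅ (A : {A : Set X // MeasurableSet A}) (B : {B : Set X // MeasurableSet B}),
    TopologicalSpace.induced (AutMP.dist A.1 B.1) inferInstance

/-! ### Centralizer groups -/

/-- The image in `Aut_mp(X, μ)` of an element of a group that acts on `X` by measure preserving
transformations. -/
def AutMP.ofSMul {X Λ : Type u} [MeasurableSpace X] (μ : Measure X) [Group Λ] [MulAction Λ X]
    [MeasurableConstSMul Λ X] [SMulInvariantMeasure Λ X μ] (g : Λ) : AutMP μ :=
  AutMP.mk (MeasurableEquiv.smul g) (measurePreserving_smul g μ)

/-- A topological group `G` is a centralizer group if it is a Polish group and there is an ergodic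
probability measure preserving action of a countable group `Λ` on a standard probability space
`(X, μ)` such that `G` is isomorphic, as a topological group, with the centralizer of `Λ` inside
`Aut_mp(X, μ)`. -/
def IsCentralizerGroup (G : Type u) [Group G] [TopologicalSpace G] : Prop :=
  IsTopologicalGroup G ∧ PolishSpace G ∧
    ∃ (X : Type u) (_ : MeasurableSpace X) (_ : StandardBorelSpace X)
      (μ : Measure X) (_ : IsProbabilityMeasure μ)
      (Λ : Type u) (_ : Group Λ) (_ : Countable Λ)
      (_ : MulAction Λ X) (_ : MeasurableConstSMul Λ X) (_ : ErgodicSMul Λ X μ),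
      Nonempty (G ≃ₜ* Subgroup.centralizer (Set.range (AutMP.ofSMul (Λ := Λ) μ)))

/-! ### The automorphism group of a topological group -/

/-- The topology on the homeomorphism group of a space for which `f` varies continuously when `f`
and its inverse do so in the compact-open topology. For a compact Hausdorff space this is the
topology of uniform convergence. -/
instance homeoTopology (K : Type u) [TopologicalSpace K] : TopologicalSpace (K ≃ₜ K) :=
  TopologicalSpace.induced (fun f => ((f : C(K, K)), (f.symm : C(K, K)))) inferInstance

/-- `Aut K`: the group of bicontinuous group automorphisms of `K`, as a subgroup of the
homeomorphism group, with the subspace topology. -/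
def autGroup (K : Type u) [Group K] [TopologicalSpace K] : Subgroup (K ≃ₜ K) where
  carrier := {f | ∀ x y, f (x * y) = f x * f y}
  mul_mem' := by
    intro a b ha hb x y
    change a (b (x * y)) = a (b x) * a (b y)
    rw [hb, ha]
  one_mem' := fun _ _ => rfl
  inv_mem' := by
    intro a ha x y
    change a.symm (x * y) = a.symm x * a.symm y
    rw [Homeomorph.symm_apply_eq, ha, a.apply_symm_apply, a.apply_symm_apply]

/-! ### Transformations of `(K, m)^ℕ` -/

/-- The infinite product measure `m^ℕ` on `K^ℕ`. -/
abbrev powMeasure {K : Type u} [MeasurableSpace K] (m : Measure K) [IsProbabilityMeasure m] :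
    Measure (ℕ → K) := Measure.infinitePi (fun _ : ℕ => m)

/-- The permutation of coordinates `(σ x)_n = x_{σ⁻¹(n)}`. -/
def coordPermEquiv (K : Type u) [MeasurableSpace K] (σ : Equiv.Perm ℕ) :
    (ℕ → K) ≃ᵐ (ℕ → K) where
  toFun x := fun n => x (σ.symm n)
  invFun x := fun n => x (σ n)
  left_inv x := by ext n; simp
  right_inv x := by ext n; simp
  measurable_toFun := by dsimp; fun_prop
  measurable_invFun := by dsimp; fun_prop

theorem coordPerm_mp {K : Type u} [MeasurableSpace K] (m : Measure K) [IsProbabilityMeasure m]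
    (σ : Equiv.Perm ℕ) :
    MeasurePreserving (coordPermEquiv K σ) (powMeasure m) (powMeasure m) := by
  refine ⟨(coordPermEquiv K σ).measurable, ?_⟩
  have h := Measure.infinitePi_map_piCongrLeft (X := fun _ : ℕ => K) (fun _ : ℕ => m) σ
  have e : (coordPermEquiv K σ : (ℕ → K) → (ℕ → K)) =
      MeasurableEquiv.piCongrLeft (fun _ : ℕ => K) σ := by
    ext x n
    obtain ⟨k, rfl⟩ := σ.surjective n
    rw [MeasurableEquiv.coe_piCongrLeft, Equiv.piCongrLeft_apply_apply]
    simp [coordPermEquiv]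
  rw [e]
  exact h

/-- The action of the permutations of `ℕ` on `(K, m)^ℕ`. -/
def coordPerm {K : Type u} [MeasurableSpace K] (m : Measure K) [IsProbabilityMeasure m]
    (σ : Equiv.Perm ℕ) : AutMP (powMeasure m) :=
  AutMP.mk (coordPermEquiv K σ) (coordPerm_mp m σ)

/-- The map `θ` that replaces the first coordinate by the product of the first two coordinates and
leaves the other coordinates unchanged. -/
def mulFirstEquiv (K : Type u) [Group K] [MeasurableSpace K] [MeasurableMul₂ K]
    [MeasurableInv K] : (ℕ → K) ≃ᵐ (ℕ → K) where
  toFun x := fun n => if n = 0 then x 0 * x 1 else x n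
  invFun x := fun n => if n = 0 then x 0 * (x 1)⁻¹ else x n
  left_inv x := by
    ext n
    by_cases hn : n = 0 <;> simp [hn]
  right_inv x := by
    ext n
    by_cases hn : n = 0 <;> simp [hn]
  measurable_toFun := by
    refine measurable_pi_iff.2 fun n => ?_
    by_cases hn : n = 0
    · have h : Measurable fun x : ℕ → K => x 0 * x 1 := by fun_prop
      simpa [hn] using h
    · simpa [hn] using measurable_pi_apply n
  measurable_invFun := by
    refine measurable_pi_iff.2 fun n => ?_
    by_cases hn : n = 0
    · have h : Measurable fun x : ℕ → K => x 0 * (x 1)⁻¹ := by fun_prop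
      simpa [hn] using h
    · simpa [hn] using measurable_pi_apply n

/-- Prepending a coordinate. -/
def prependCoord {K : Type u} (p : (ℕ → K) × K) : ℕ → K :=
  fun n => Nat.casesOn n p.2 p.1

theorem prependCoord_measurable {K : Type u} [MeasurableSpace K] :
    Measurable (prependCoord (K := K)) := by
  refine measurable_pi_iff.2 fun n => ?_
  cases n with
  | zero => exact measurable_snd
  | succ n => exact (measurable_pi_apply n).comp measurable_fst

theorem prependCoord_mp {K : Type u} [MeasurableSpace K] (m : Measure K)
    [IsProbabilityMeasure m] :
    MeasurePreserving (prependCoord (K := K)) ((powMeasure m).prod m) (powMeasure m) := by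
  refine ⟨prependCoord_measurable, Measure.eq_infinitePi _ fun s t ht => ?_⟩
  classical
  let t' : ℕ → Set K := fun i => if i ∈ s then t i else Set.univ
  have ht' : ∀ i, MeasurableSet (t' i) := by
    intro i
    by_cases hi : i ∈ s <;> simp [t', hi, ht]
  obtain ⟨N, hN⟩ : ∃ N, s ⊆ Finset.range (N + 1) :=
    ⟨s.sup id, fun i hi => Finset.mem_range.2 (Nat.lt_succ_of_le (Finset.le_sup (f := id) hi))⟩
  have hpre : prependCoord ⁻¹' ((s : Set ℕ).pi t) =
      (((Finset.range N : Finset ℕ) : Set ℕ).pi fun i => t' (i + 1)) ×ˢ t' 0 := by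
    ext p
    simp only [Set.mem_preimage, Set.mem_pi, Set.mem_prod, Finset.mem_coe, Finset.mem_range]
    constructor
    · intro h
      refine ⟨fun i _ => ?_, ?_⟩
      · by_cases hs : i + 1 ∈ s
        · simpa [t', hs, prependCoord] using h _ hs
        · simp [t', hs]
      · by_cases hs : 0 ∈ s
        · simpa [t', hs, prependCoord] using h _ hs
        · simp [t', hs]
    · rintro ⟨h1, h0⟩ i hi
      cases i with
      | zero => simpa [t', hi, prependCoord] using h0
      | succ i =>
        have := h1 i (by simpa using hN hi)
        simpa [t', hi, prependCoord] using this
  rw [Measure.map_apply prependCoord_measurable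
    (MeasurableSet.pi s.countable_toSet fun i _ => ht i), hpre, Measure.prod_prod,
    Measure.infinitePi_pi _ (fun i _ => ht' (i + 1)),
    ← Finset.prod_range_succ' (fun i => m (t' i)) N]
  rw [← Finset.prod_subset hN]
  · exact Finset.prod_congr rfl fun i hi => by simp [t', hi]
  · intro i _ hi
    simp [t', hi]

theorem mulFirst_mp {K : Type u} [Group K] [MeasurableSpace K] [MeasurableMul₂ K]
    [MeasurableInv K] (m : Measure K) [IsProbabilityMeasure m] [m.IsMulRightInvariant] :
    MeasurePreserving (mulFirstEquiv K) (powMeasure m) (powMeasure m) := by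
  have hskew : MeasurePreserving (fun p : (ℕ → K) × K => (id p.1, p.2 * p.1 0))
      ((powMeasure m).prod m) ((powMeasure m).prod m) :=
    (MeasurePreserving.id _).skew_product
      (g := fun (y : ℕ → K) (a : K) => a * y 0)
      (by unfold Function.uncurry; fun_prop)
      (Filter.Eventually.of_forall fun y => map_mul_right_eq_self m (y 0))
  have hcomm : (mulFirstEquiv K : (ℕ → K) → (ℕ → K)) ∘ prependCoord =
      prependCoord ∘ fun p : (ℕ → K) × K => (id p.1, p.2 * p.1 0) := by
    funext p n
    cases n <;> simp [mulFirstEquiv, prependCoord]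
  refine ⟨(mulFirstEquiv K).measurable, ?_⟩
  conv_lhs => rw [← (prependCoord_mp m).map_eq]
  rw [Measure.map_map (mulFirstEquiv K).measurable prependCoord_measurable, hcomm]
  exact ((prependCoord_mp m).comp hskew).map_eq

/-- The element `θ` of `Aut_mp((K, m)^ℕ)`. -/
def mulFirst {K : Type u} [Group K] [MeasurableSpace K] [MeasurableMul₂ K]
    [MeasurableInv K] (m : Measure K) [IsProbabilityMeasure m] [m.IsMulRightInvariant] :
    AutMP (powMeasure m) :=
  AutMP.mk (mulFirstEquiv K) (mulFirst_mp m)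

/-- The diagonal transformation `(φ_α x)_n = α (x_n)`. -/
def diagEquiv {K : Type u} [MeasurableSpace K] (α : K ≃ᵐ K) : (ℕ → K) ≃ᵐ (ℕ → K) where
  toFun x := fun n => α (x n)
  invFun x := fun n => α.symm (x n)
  left_inv x := by ext n; simp
  right_inv x := by ext n; simp
  measurable_toFun := by dsimp; fun_prop
  measurable_invFun := by dsimp; fun_prop

theorem diag_mp {K : Type u} [MeasurableSpace K] {m : Measure K} [IsProbabilityMeasure m]
    (α : K ≃ᵐ K) (hα : MeasurePreserving α m m) :
    MeasurePreserving (diagEquiv α) (powMeasure m) (powMeasure m) := by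
  refine ⟨(diagEquiv α).measurable, ?_⟩
  have h := Measure.infinitePi_map_pi (fun _ : ℕ => m) (f := fun _ : ℕ => (α : K → K))
    (fun _ => α.measurable)
  simp only [hα.map_eq] at h
  exact h

/-- The element `φ_α` of `Aut_mp((K, m)^ℕ)`. -/
def diag {K : Type u} [MeasurableSpace K] {m : Measure K} [IsProbabilityMeasure m]
    (α : K ≃ᵐ K) (hα : MeasurePreserving α m m) : AutMP (powMeasure m) :=
  AutMP.mk (diagEquiv α) (diag_mp α hα)

/-- The Haar probability measure of a compact group is right invariant. -/
instance haar_isMulRightInvariant {K : Type u} [Group K] [TopologicalSpace K]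
    [IsTopologicalGroup K] [CompactSpace K] [MeasurableSpace K] [BorelSpace K]
    (m : Measure K) [m.IsHaarMeasure] [IsProbabilityMeasure m] : m.IsMulRightInvariant where
  map_mul_right_eq_self g := by
    have : IsProbabilityMeasure (m.map (· * g)) :=
      Measure.isProbabilityMeasure_map (measurable_mul_const g).aemeasurable
    exact Measure.isHaarMeasure_eq_of_isProbabilityMeasure _ m

theorem autGroup_mp {K : Type u} [Group K] [TopologicalSpace K]
    [IsTopologicalGroup K] [CompactSpace K] [MeasurableSpace K] [BorelSpace K]
    (m : Measure K) [m.IsHaarMeasure] [IsProbabilityMeasure m] (β : autGroup K) :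
    MeasurePreserving β.1.toMeasurableEquiv m m := by
  refine ⟨β.1.toMeasurableEquiv.measurable, ?_⟩
  have h1 : IsProbabilityMeasure (m.map β.1.toMeasurableEquiv) :=
    Measure.isProbabilityMeasure_map β.1.toMeasurableEquiv.measurable.aemeasurable
  have h2 : (m.map β.1.toMeasurableEquiv).IsHaarMeasure :=
    MulEquiv.isHaarMeasure_map m (MulEquiv.mk β.1.toEquiv β.2) β.1.continuous
      β.1.symm.continuous
  exact Measure.isHaarMeasure_eq_of_isProbabilityMeasure _ m

/-- The diagonal transformation of `(K, m)^ℕ` given by a continuous automorphism of `K`, where `m`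
is the Haar probability measure. -/
def autDiag {K : Type u} [Group K] [TopologicalSpace K]
    [IsTopologicalGroup K] [CompactSpace K] [MeasurableSpace K] [BorelSpace K]
    (m : Measure K) [m.IsHaarMeasure] [IsProbabilityMeasure m] (β : autGroup K) :
    AutMP (powMeasure m) :=
  diag β.1.toMeasurableEquiv (autGroup_mp m β)

/-- The subgroup of `Aut_mp((K, m)^ℕ)` generated by all permutations of the coordinates and `θ`. -/
def permMulGroup {K : Type u} [Group K] [MeasurableSpace K] [MeasurableMul₂ K]
    [MeasurableInv K] (m : Measure K) [IsProbabilityMeasure m] [m.IsMulRightInvariant] :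
    Subgroup (AutMP (powMeasure m)) :=
  Subgroup.closure (Set.range (coordPerm m) ∪ {mulFirst m})

end

/-!
Let `T` commute with the transpositions of coordinates and with `θ`. For almost every `t : K`, the
map `x ↦ (T x) 0` restricted to `x 0 = t` is invariant under transpositions of the other
coordinates, hence almost everywhere constant by the Hewitt–Savage zero-one law. So
`(T x) 0 = α (x 0)`, and conjugating by transpositions gives `(T x) n = α (x n)` for all `n`. As `T`
commutes with `θ`, the map `α` is multiplicative almost everywhere, so it agrees almost everywhere
with a homomorphism, which is continuous because it is measurable. The same argument for `T⁻¹`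
yields its inverse, so `T = φ_β` for an automorphism `β`.

That `β ↦ φ_β` is an embedding rests on the fact that homomorphisms converging in measure converge
uniformly: `f x / g x` is determined by `g x` and the values of `f / g` at `x * z` and `z`, and `z`
can be chosen so that both values are close to `1`.

Finally, the transpositions and `θ` already generate a countable group. It acts ergodically, again
by the Hewitt–Savage law, and its centralizer is the same.
-/

section

open ProbabilityTheory Filter Topology

/-! ### Coordinates of an infinite product -/

section InfiniteProduct

variable {ι κ κ' : Type*} {Ω : ι → Type*} [∀ i, MeasurableSpace (Ω i)]
  (P : ∀ i, Measure (Ω i)) [∀ i, IsProbabilityMeasure (P i)]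

theorem measurePreserving_reindex_infinitePi {f : κ → ι} (hf : f.Injective) :
    MeasurePreserving (fun (x : ∀ i, Ω i) k => x (f k)) (Measure.infinitePi P)
      (Measure.infinitePi fun k => P (f k)) :=
  ⟨by fun_prop, Measure.map_infinitePi_infinitePi_of_inj hf⟩

theorem comap_reindex_le_iSup_comap_eval (f : κ → ι) :
    MeasurableSpace.comap (fun (x : ∀ i, Ω i) k => x (f k)) inferInstance ≤
      ⨆ i ∈ Set.range f, MeasurableSpace.comap (fun x : ∀ i, Ω i => x i) inferInstance := by
  simp only [MeasurableSpace.pi, MeasurableSpace.comap_iSup, MeasurableSpace.comap_comp]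
  exact iSup_le fun k => le_iSup₂_of_le (f k) ⟨k, rfl⟩ le_rfl

theorem indepFun_reindex_infinitePi {f : κ → ι} {g : κ' → ι}
    (hfg : Disjoint (Set.range f) (Set.range g)) :
    IndepFun (fun (x : ∀ i, Ω i) k => x (f k)) (fun x k => x (g k)) (Measure.infinitePi P) := by
  have indep_coord : iIndep (fun i => MeasurableSpace.comap (fun x : ∀ i, Ω i => x i) inferInstance)
      (Measure.infinitePi P) :=
    iIndepFun_infinitePi (X := fun _ x => x) fun _ => measurable_id
  have indep_ranges := indep_iSup_of_disjoint (fun i => (measurable_pi_apply i).comap_le)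
    indep_coord hfg
  exact indep_of_indep_of_le_left
    (indep_of_indep_of_le_right indep_ranges (comap_reindex_le_iSup_comap_eval g))
    (comap_reindex_le_iSup_comap_eval f)

theorem measurePreserving_eval_pair_infinitePi {i j : ι} (hij : i ≠ j) :
    MeasurePreserving (fun x : ∀ i, Ω i => (x i, x j)) (Measure.infinitePi P)
      ((P i).prod (P j)) := by
  have eval := measurePreserving_eval_infinitePi P
  have indep : IndepFun (fun x : ∀ i, Ω i => x i) (fun x => x j) (Measure.infinitePi P) :=
    (iIndepFun_infinitePi (X := fun _ x => x) fun _ => measurable_id).indepFun hij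
  refine ⟨by fun_prop, ?_⟩
  rw [(indepFun_iff_map_prod_eq_prod_map_map (eval i).aemeasurable (eval j).aemeasurable).1 indep]
  exact congrArg₂ Measure.prod (eval i).map_eq (eval j).map_eq

end InfiniteProduct

/-! ### The Hewitt–Savage zero-one law -/

section HewittSavage

variable {ι X : Type*} [MeasurableSpace X] (m : Measure X) [IsProbabilityMeasure m]

theorem exists_perm_eqOn_finset_of_swap_mem [DecidableEq ι] {H : Submonoid (Equiv.Perm ι)}
    (hH : ∀ i j, Equiv.swap i j ∈ H) {f : ι → ι} (hf : f.Injective) (t : Finset ι) :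
    ∃ σ ∈ H, ∀ i ∈ t, σ i = f i := by
  induction t using Finset.induction_on with
  | empty => exact ⟨1, H.one_mem, by simp⟩
  | insert a t ha ih =>
    obtain ⟨σ, hσH, hσ⟩ := ih
    refine ⟨Equiv.swap (σ a) (f a) * σ, H.mul_mem (hH _ _) hσH, fun i hi => ?_⟩
    obtain rfl | hit := Finset.mem_insert.1 hi
    · simp
    · have hia : i ≠ a := ne_of_mem_of_not_mem hit ha
      rw [Equiv.Perm.mul_apply, hσ i hit, Equiv.swap_apply_of_ne_of_ne]
      · exact fun h => hia (σ.injective ((hσ i hit).trans h))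
      · exact fun h => hia (hf h)

/-- The permutations of the coordinates that leave a subset of `X ^ ι` invariant up to a set of
measure zero. The Hewitt–Savage law concerns the sets for which it contains all transpositions. -/
def aeInvariantPerms (s : Set (ι → X)) : Submonoid (Equiv.Perm ι) where
  carrier := {σ | (fun x : ι → X => x ∘ σ) ⁻¹' s =ᵐ[Measure.infinitePi fun _ => m] s}
  one_mem' := ae_eq_refl s
  mul_mem' {σ _} hσ hτ :=
    ((measurePreserving_reindex_infinitePi (fun _ => m) σ.injective).quasiMeasurePreserving
      |>.preimage_ae_eq hτ).trans hσ

theorem exists_finset_dependsOn_measure_symmDiff_lt {s : Set (ι → X)} (hs : MeasurableSet s)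
    {ε : ℝ≥0∞} (hε : 0 < ε) :
    ∃ (C : Set (ι → X)) (t : Finset ι), MeasurableSet C ∧ DependsOn (· ∈ C) t ∧
      Measure.infinitePi (fun _ => m) (C ∆ s) < ε := by
  obtain ⟨C, hC, hCs⟩ := exists_measure_symmDiff_lt_of_generateFrom_isSetRing
    (μ := Measure.infinitePi fun _ : ι => m) (isSetRing_measurableCylinders (α := fun _ => X))
    ⟨{Set.univ}, Set.countable_singleton _,
      Set.singleton_subset_iff.2 (univ_mem_measurableCylinders _), by simp⟩
    generateFrom_measurableCylinders.symm hs hε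
  obtain ⟨t, S, hS, rfl⟩ := (mem_measurableCylinders C).1 hC
  exact ⟨_, t, hS.cylinder, fun x y hxy => by
    simp only [mem_cylinder, Finset.restrict_def, hxy _ (Subtype.prop _)], hCs⟩

theorem preimage_reindex_ae_eq_of_swap_invariant [DecidableEq ι] {s : Set (ι → X)}
    (hs : MeasurableSet s) (hswap : ∀ i j, Equiv.swap i j ∈ aeInvariantPerms m s)
    {f : ι → ι} (hf : f.Injective) :
    (fun x : ι → X => x ∘ f) ⁻¹' s =ᵐ[Measure.infinitePi fun _ => m] s := by
  set μ := Measure.infinitePi fun _ : ι => m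
  have mp {g : ι → ι} (hg : g.Injective) : MeasurePreserving (fun x : ι → X => x ∘ g) μ μ :=
    measurePreserving_reindex_infinitePi (fun _ => m) hg
  refine measure_symmDiff_eq_zero_iff.1 (le_antisymm (ENNReal.le_of_forall_pos_le_add
    fun ε hε _ => ?_) zero_le)
  obtain ⟨C, t, hC, hCt, hCs⟩ := exists_finset_dependsOn_measure_symmDiff_lt m hs
    (ENNReal.half_pos (ENNReal.coe_pos.2 hε).ne')
  obtain ⟨σ, hσ, hσf⟩ := exists_perm_eqOn_finset_of_swap_mem hswap hf t
  have preimage_C : (fun x : ι → X => x ∘ f) ⁻¹' C = (fun x => x ∘ σ) ⁻¹' C :=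
    Set.ext fun x => iff_of_eq (hCt fun i hi => congrArg x (hσf i hi).symm)
  have preimage_symmDiff {g : ι → ι} (hg : g.Injective) :
      μ (((fun x => x ∘ g) ⁻¹' C) ∆ ((fun x => x ∘ g) ⁻¹' s)) = μ (C ∆ s) :=
    (mp hg).measure_preimage (hC.symmDiff hs).nullMeasurableSet
  calc μ (((fun x => x ∘ f) ⁻¹' s) ∆ s)
      ≤ μ (((fun x => x ∘ f) ⁻¹' s) ∆ ((fun x => x ∘ σ) ⁻¹' C)) +
          (μ (((fun x => x ∘ σ) ⁻¹' C) ∆ ((fun x => x ∘ σ) ⁻¹' s)) +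
            μ (((fun x => x ∘ σ) ⁻¹' s) ∆ s)) :=
        (measure_symmDiff_le _ _ _).trans (add_le_add_right (measure_symmDiff_le _ _ _) _)
    _ = μ (C ∆ s) + μ (C ∆ s) := by
        rw [measure_symmDiff_eq_zero_iff.2 hσ, add_zero, preimage_symmDiff σ.injective,
          symmDiff_comm, ← preimage_C, preimage_symmDiff hf]
    _ ≤ 0 + ε := by
        rw [zero_add, ← ENNReal.add_halves (ε : ℝ≥0∞)]
        gcongr

theorem exists_injective_disjoint_range (ι : Type*) [Infinite ι] :
    ∃ f g : ι → ι, f.Injective ∧ g.Injective ∧ Disjoint (Set.range f) (Set.range g) := by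
  obtain ⟨e⟩ : Nonempty (ι ⊕ ι ≃ ι) := Cardinal.eq.1 (by simp)
  refine ⟨e ∘ Sum.inl, e ∘ Sum.inr, e.injective.comp Sum.inl_injective,
    e.injective.comp Sum.inr_injective, ?_⟩
  rw [Set.range_comp, Set.range_comp, Set.disjoint_image_iff e.injective]
  exact Set.isCompl_range_inl_range_inr.disjoint

theorem measure_eq_zero_or_one_of_swap_invariant [Infinite ι] [DecidableEq ι] {s : Set (ι → X)}
    (hs : MeasurableSet s) (hswap : ∀ i j, Equiv.swap i j ∈ aeInvariantPerms m s) :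
    Measure.infinitePi (fun _ => m) s = 0 ∨ Measure.infinitePi (fun _ => m) s = 1 := by
  set μ := Measure.infinitePi fun _ : ι => m
  obtain ⟨f, g, hf, hg, hfg⟩ := exists_injective_disjoint_range ι
  have inv_f := preimage_reindex_ae_eq_of_swap_invariant m hs hswap hf
  have inv_g := preimage_reindex_ae_eq_of_swap_invariant m hs hswap hg
  have indep := (indepFun_reindex_infinitePi (fun _ => m) hfg).measure_inter_preimage_eq_mul s s
    hs hs
  refine measure_eq_zero_or_one_of_indepSet_self
    ((indepSet_iff_measure_inter_eq_mul hs hs μ).2 ?_)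
  calc μ (s ∩ s) = μ ((fun x : ι → X => x ∘ f) ⁻¹' s ∩ (fun x => x ∘ g) ⁻¹' s) :=
        measure_congr (inv_f.inter inv_g).symm
    _ = μ ((fun x => x ∘ f) ⁻¹' s) * μ ((fun x => x ∘ g) ⁻¹' s) := indep
    _ = μ s * μ s := by rw [measure_congr inv_f, measure_congr inv_g]

theorem eventuallyConst_of_swap_invariant [Infinite ι] [DecidableEq ι] {s : Set (ι → X)}
    (hs : MeasurableSet s) (hswap : ∀ i j, Equiv.swap i j ∈ aeInvariantPerms m s) :
    Filter.EventuallyConst s (ae (Measure.infinitePi fun _ : ι => m)) := by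
  rw [Filter.eventuallyConst_set]
  obtain h | h := measure_eq_zero_or_one_of_swap_invariant m hs hswap
  · exact Or.inr (measure_eq_zero_iff_ae_notMem.1 h)
  · exact Or.inl ((mem_ae_iff_prob_eq_one hs).2 h)

theorem exists_ae_eq_const_of_swap_invariant [Infinite ι] [DecidableEq ι] {Z : Type*}
    [MeasurableSpace Z] [MeasurableSpace.CountablySeparated Z] {F : (ι → X) → Z}
    (hF : Measurable F)
    (hswap : ∀ i j, (fun x => F (x ∘ Equiv.swap i j)) =ᵐ[Measure.infinitePi fun _ => m] F) :
    ∃ c, F =ᵐ[Measure.infinitePi fun _ => m] Function.const _ c := by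
  obtain ⟨x⟩ := (Measure.infinitePi fun _ : ι => m).nonempty_of_neZero
  have : Nonempty Z := ⟨F x⟩
  refine Filter.exists_eventuallyEq_const_of_forall_separating MeasurableSet fun U hU =>
    Filter.eventuallyConst_set.1 (eventuallyConst_of_swap_invariant m (hF hU) fun i j => ?_)
  filter_upwards [hswap i j] with x hx
  exact congrArg (· ∈ U) hx

end HewittSavage

theorem prependCoord_comp_swap_succ {X : Type*} (p : (ℕ → X) × X) (i j : ℕ) :
    prependCoord p ∘ Equiv.swap (i + 1) (j + 1) = prependCoord (p.1 ∘ Equiv.swap i j, p.2) := by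
  funext n
  cases n with
  | zero => simp [prependCoord, Equiv.swap_apply_of_ne_of_ne]
  | succ n =>
    exact congrArg (prependCoord p) (Nat.succ_injective.swap_apply i j n)

section SwapInvariantFunctions

variable {X Y Z : Type*} [MeasurableSpace X] [MeasurableSpace Y] [MeasurableSpace Z]

theorem ae_eq_of_ae_eq_comp_measurePreserving [MeasurableEq Z] {μ : Measure X} {ν : Measure Y}
    {f : X → Y} (hf : MeasurePreserving f μ ν) {u v : Y → Z} (hu : Measurable u)
    (hv : Measurable v) (h : ∀ᵐ x ∂μ, u (f x) = v (f x)) : ∀ᵐ y ∂ν, u y = v y := by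
  rw [← hf.map_eq]
  exact (ae_map_iff hf.aemeasurable (measurableSet_eq_fun hu hv)).2 h

theorem exists_measurable_ae_eq_comp_snd [MeasurableEq Z] {μ : Measure X} [SFinite μ] [NeZero μ]
    {ν : Measure Y} [SFinite ν] {F : X × Y → Z} (hF : Measurable F)
    (hconst : ∀ᵐ y ∂ν, ∃ c, ∀ᵐ x ∂μ, F (x, y) = c) :
    ∃ α : Y → Z, Measurable α ∧ ∀ᵐ p ∂μ.prod ν, F p = α p.2 := by
  have ae_eq_pairs : ∀ᵐ y ∂ν, ∀ᵐ q ∂μ.prod μ, F (q.1, y) = F (q.2, y) := by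
    filter_upwards [hconst] with y ⟨c, hc⟩
    filter_upwards [Measure.quasiMeasurePreserving_fst.ae hc,
      Measure.quasiMeasurePreserving_snd.ae hc] with q h1 h2
    exact h1.trans h2.symm
  have ae_eq_sections : ∀ᵐ q ∂μ.prod μ, ∀ᵐ y ∂ν, F (q.1, y) = F (q.2, y) :=
    (Measure.ae_ae_comm (p := fun y (q : X × X) => F (q.1, y) = F (q.2, y))
      (measurableSet_eq_fun (by fun_prop) (by fun_prop))).1 ae_eq_pairs
  obtain ⟨x₀, hx₀⟩ := (Measure.ae_ae_of_ae_prod ae_eq_sections).exists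
  have measurable_section : Measurable fun y => F (x₀, y) := by fun_prop
  refine ⟨_, measurable_section, (Measure.ae_prod_iff_ae_ae (measurableSet_eq_fun hF
    (measurable_section.comp measurable_snd))).2 ?_⟩
  filter_upwards [hx₀] with x hx
  exact hx.mono fun y hy => hy.symm

theorem measurableEq_of_countablySeparated [MeasurableSpace.CountablySeparated Z] :
    MeasurableEq Z := by
  obtain ⟨f, hf, hf_inj⟩ := MeasurableSpace.measurable_injection_nat_bool_of_countablySeparated Z
  refine ⟨?_⟩
  simpa only [Set.diagonal, Function.comp_apply, hf_inj.eq_iff] using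
    measurableSet_eq_fun (hf.comp measurable_fst) (hf.comp measurable_snd)

theorem exists_measurable_ae_eq_comp_eval_zero_of_swap_invariant (m : Measure X)
    [IsProbabilityMeasure m] [MeasurableSpace.CountablySeparated Z]
    {F : (ℕ → X) → Z} (hF : Measurable F)
    (hswap : ∀ i j : ℕ, i ≠ 0 → j ≠ 0 →
      (fun x => F (x ∘ Equiv.swap i j)) =ᵐ[powMeasure m] F) :
    ∃ α : X → Z, Measurable α ∧ ∀ᵐ x ∂powMeasure m, F x = α (x 0) := by
  have := measurableEq_of_countablySeparated (Z := Z)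
  have hG : Measurable fun p : (ℕ → X) × X => F (prependCoord p) :=
    hF.comp prependCoord_measurable
  have swap_tail (i j : ℕ) : ∀ᵐ t ∂m, ∀ᵐ y ∂powMeasure m,
      F (prependCoord (y ∘ Equiv.swap i j, t)) = F (prependCoord (y, t)) := by
    have ae_prod : ∀ᵐ p ∂(powMeasure m).prod m,
        F (prependCoord (p.1 ∘ Equiv.swap i j, p.2)) = F (prependCoord p) := by
      filter_upwards [(prependCoord_mp m).quasiMeasurePreserving.ae
        (hswap _ _ i.succ_ne_zero j.succ_ne_zero)] with p hp
      rwa [prependCoord_comp_swap_succ] at hp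
    exact (Measure.ae_ae_comm (p := fun (y : ℕ → X) t =>
      F (prependCoord (y ∘ Equiv.swap i j, t)) = F (prependCoord (y, t)))
      (measurableSet_eq_fun (hG.comp (by fun_prop)) hG)).1 (Measure.ae_ae_of_ae_prod ae_prod)
  have ae_const_in_tail : ∀ᵐ t ∂m, ∃ c, ∀ᵐ y ∂powMeasure m, F (prependCoord (y, t)) = c := by
    filter_upwards [ae_all_iff.2 fun i => ae_all_iff.2 (swap_tail i)] with t ht
    exact exists_ae_eq_const_of_swap_invariant m (hG.comp (by fun_prop)) ht
  obtain ⟨α, hα, hFα⟩ := exists_measurable_ae_eq_comp_snd hG ae_const_in_tail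
  exact ⟨α, hα, ae_eq_of_ae_eq_comp_measurePreserving (prependCoord_mp m) hF
    (hα.comp (measurable_pi_apply 0)) hFα⟩

end SwapInvariantFunctions

/-! ### Almost everywhere multiplicative maps -/

section AEMultiplicative

variable {G H : Type*} [Group G] [MeasurableSpace G]

/-- The graph of the homomorphism that agrees almost everywhere with a map `α` which is
multiplicative almost everywhere, see `exists_monoidHom_ae_eq`. -/
def aeTranslationGraph [MeasurableMul G] [Group H] (μ : Measure G) [μ.IsMulLeftInvariant]
    (α : G → H) : Subgroup (G × H) where
  carrier := {p | ∀ᵐ y ∂μ, α (p.1 * y) = p.2 * α y}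
  one_mem' := by simp
  mul_mem' {p q} hp hq := by
    simp only [Set.mem_ofPred_eq] at *
    filter_upwards [(measurePreserving_mul_left μ q.1).quasiMeasurePreserving.ae hp, hq]
      with y hpy hqy
    rw [Prod.fst_mul, Prod.snd_mul, mul_assoc, hpy, hqy, mul_assoc]
  inv_mem' {p} hp := by
    simp only [Set.mem_ofPred_eq] at *
    filter_upwards [(measurePreserving_mul_left μ p.1⁻¹).quasiMeasurePreserving.ae hp] with y hy
    rw [Prod.fst_inv, Prod.snd_inv, eq_inv_mul_iff_mul_eq, ← hy, mul_inv_cancel_left]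

theorem exists_monoidHom_ae_eq [MeasurableMul G] [Group H] {μ : Measure G}
    [μ.IsMulLeftInvariant] [NeZero μ] {α : G → H}
    (hα : ∀ᵐ x ∂μ, ∀ᵐ y ∂μ, α (x * y) = α x * α y) : ∃ β : G →* H, α =ᵐ[μ] β := by
  have mem_graph : ∀ᵐ x ∂μ, (x, α x) ∈ aeTranslationGraph μ α := hα
  have injective_fst :
      Function.Injective (Prod.fst ∘ (aeTranslationGraph μ α).subtype) := by
    rintro ⟨⟨x, c⟩, hc⟩ ⟨⟨_, d⟩, hd⟩ rfl
    have hc : ∀ᵐ y ∂μ, α (x * y) = c * α y := hc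
    have hd : ∀ᵐ y ∂μ, α (x * y) = d * α y := hd
    obtain ⟨y, hcy, hdy⟩ := (hc.and hd).exists
    simpa using hcy.symm.trans hdy
  have surjective_fst :
      Function.Surjective (Prod.fst ∘ (aeTranslationGraph μ α).subtype) := by
    intro x
    obtain ⟨a, ha, hxa⟩ := (mem_graph.and
      ((measurePreserving_mul_left μ x⁻¹).quasiMeasurePreserving.ae mem_graph)).exists
    exact ⟨⟨_, mul_mem ha (inv_mem hxa)⟩, by simp⟩
  obtain ⟨β, hβ⟩ := Subgroup.exists_eq_graph ⟨injective_fst, surjective_fst⟩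
  exact ⟨β, mem_graph.mono fun x hx => (MonoidHom.mem_graph.1 (hβ ▸ hx)).symm⟩

variable [TopologicalSpace H]

theorem exists_isOpen_mem_forall_div_mem [Group H] [IsTopologicalGroup H] {U : Set H}
    (hU : U ∈ 𝓝 1) (c : H) : ∃ O, IsOpen O ∧ c ∈ O ∧ ∀ a ∈ O, ∀ b ∈ O, a / b ∈ U := by
  have hdiv : ∀ᶠ p : H × H in 𝓝 (c, c), p.1 / p.2 ∈ U :=
    continuous_div'.continuousAt (by simpa using hU)
  rw [nhds_prod_eq] at hdiv
  obtain ⟨V, hV, hVU⟩ := mem_prod_self_iff.1 hdiv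
  obtain ⟨O, hOV, hO, hcO⟩ := mem_nhds_iff.1 hV
  exact ⟨O, hO, hcO, fun a ha b hb => hVU (Set.mk_mem_prod (hOV ha) (hOV hb))⟩

theorem continuous_monoidHom_of_aemeasurable [TopologicalSpace G] [IsTopologicalGroup G]
    [LocallyCompactSpace G] [BorelSpace G] {μ : Measure G} [μ.IsHaarMeasure] [μ.InnerRegular]
    [Group H] [IsTopologicalGroup H] [SecondCountableTopology H] [MeasurableSpace H]
    [OpensMeasurableSpace H] (β : G →* H) (hβ : AEMeasurable β μ) : Continuous β := by
  refine continuous_of_continuousAt_one β ?_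
  rw [ContinuousAt, map_one]
  intro U hU
  obtain ⟨c, -, hc⟩ := exists_mem_forall_mem_nhdsWithin_pos_measure (μ := μ.map β)
    (s := Set.univ) (by simpa using (Measure.map_ne_zero_iff hβ).2 (NeZero.ne μ))
  obtain ⟨O, hO, hcO, hOU⟩ := exists_isOpen_mem_forall_div_mem hU c
  obtain ⟨E, hEO, hE, hEae⟩ :=
    (hβ.nullMeasurable hO.measurableSet).exists_measurable_subset_ae_eq
  have measure_pos : 0 < μ E := by
    rw [measure_congr hEae, ← Measure.map_apply_of_aemeasurable hβ hO.measurableSet]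
    exact hc O (by simpa using hO.mem_nhds hcO)
  refine mem_map.2 (mem_of_superset (Measure.div_mem_nhds_one_of_haar_pos μ E hE measure_pos) ?_)
  rintro _ ⟨x, hx, y, hy, rfl⟩
  rw [Set.mem_preimage, map_div]
  exact hOU _ (hEO hx) _ (hEO hy)

end AEMultiplicative

/-! ### Convergence in measure of homomorphisms -/

section ConvergenceInMeasure

variable {ι G H X : Type*} [Group G] [Group H]

theorem exists_div_eq_mul_conj_of_measure_lt [MeasurableSpace G] [MeasurableMul G] {μ : Measure G}
    [μ.IsMulLeftInvariant] [IsProbabilityMeasure μ] {f g : G →* H} {W : Set H}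
    (hW : μ {x | f x / g x ∉ W} < 2⁻¹) (x : G) :
    ∃ a ∈ W, ∃ b ∈ W, f x / g x = a * (g x * b⁻¹ * (g x)⁻¹) := by
  set D := {x | f x / g x ∉ W}
  obtain ⟨z, hz⟩ : ∃ z, z ∉ D ∪ (x * ·) ⁻¹' D := by
    by_contra! hall
    have measure_lt_one : μ (D ∪ (x * ·) ⁻¹' D) < 1 := by
      refine (measure_union_le _ _).trans_lt ?_
      rw [measure_preimage_mul, ← ENNReal.inv_two_add_inv_two]
      exact ENNReal.add_lt_add hW hW
    rw [Set.eq_univ_of_forall hall, measure_univ] at measure_lt_one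
    exact lt_irrefl _ measure_lt_one
  rw [Set.mem_union, not_or] at hz
  refine ⟨_, not_not.1 hz.2, _, not_not.1 hz.1, ?_⟩
  simp only [map_mul, div_eq_mul_inv, mul_inv_rev, inv_inv]
  group

variable [TopologicalSpace H] [IsTopologicalGroup H]

theorem exists_nhds_one_mul_conj_mem {C : Set H} (hC : IsCompact C) {U : Set H} (hU : U ∈ 𝓝 1) :
    ∃ W ∈ 𝓝 (1 : H), ∀ a ∈ W, ∀ b ∈ W, ∀ k ∈ C, a * (k * b⁻¹ * k⁻¹) ∈ U := by
  have eventually_mem : ∀ᶠ p : H × H in 𝓝 (1, 1), ∀ k ∈ C, p.1 * (k * p.2⁻¹ * k⁻¹) ∈ U := by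
    refine hC.eventually_forall_of_forall_eventually fun k _ => ?_
    have continuous_conj : Continuous fun z : (H × H) × H => z.1.1 * (z.2 * z.1.2⁻¹ * z.2⁻¹) := by
      fun_prop
    exact continuous_conj.continuousAt (by simpa using hU)
  rw [nhds_prod_eq] at eventually_mem
  obtain ⟨W, hW, hWU⟩ := mem_prod_self_iff.1 eventually_mem
  exact ⟨W, hW, fun a ha b hb => hWU (Set.mk_mem_prod ha hb)⟩

theorem tendsto_measure_div_notMem [MeasurableSpace X] {μ : Measure X} {l : Filter ι}
    {f : ι → X → H} {g : X → H} {C : Set H} (hC : IsCompact C) (hg : ∀ x, g x ∈ C)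
    (hfg : ∀ A, IsOpen A → Tendsto (fun i => μ ((f i ⁻¹' A) ∆ (g ⁻¹' A))) l (𝓝 0))
    {W : Set H} (hW : W ∈ 𝓝 1) : Tendsto (fun i => μ {x | f i x / g x ∉ W}) l (𝓝 0) := by
  choose O hO hcO hOW using exists_isOpen_mem_forall_div_mem hW
  obtain ⟨t, -, ht⟩ := hC.elim_nhds_subcover O fun c _ => (hO c).mem_nhds (hcO c)
  have tendsto_sum : Tendsto (fun i => ∑ c ∈ t, μ ((f i ⁻¹' O c) ∆ (g ⁻¹' O c))) l (𝓝 0) := by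
    simpa using tendsto_finsetSum t fun c _ => hfg (O c) (hO c)
  refine tendsto_of_tendsto_of_tendsto_of_le_of_le tendsto_const_nhds tendsto_sum
    (fun _ => zero_le) fun i => (measure_mono fun x hx => ?_).trans (measure_biUnion_finset_le t _)
  obtain ⟨c, hc, hgc⟩ := Set.mem_iUnion₂.1 (ht (hg x))
  exact Set.mem_iUnion₂.2 ⟨c, hc, Or.inr ⟨hgc, fun hfc => hx (hOW c _ hfc _ hgc)⟩⟩

theorem eventually_forall_div_mem_of_tendsto_measure [MeasurableSpace G] [MeasurableMul G]
    {μ : Measure G} [μ.IsMulLeftInvariant] [IsProbabilityMeasure μ] {l : Filter ι}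
    {f : ι → G →* H} {g : G →* H} {C : Set H} (hC : IsCompact C) (hg : ∀ x, g x ∈ C)
    (hfg : ∀ A, IsOpen A → Tendsto (fun i => μ ((f i ⁻¹' A) ∆ (g ⁻¹' A))) l (𝓝 0))
    {U : Set H} (hU : U ∈ 𝓝 1) : ∀ᶠ i in l, ∀ x, f i x / g x ∈ U := by
  obtain ⟨W, hW, hWU⟩ := exists_nhds_one_mul_conj_mem hC hU
  filter_upwards [(tendsto_measure_div_notMem hC hg hfg hW).eventually_lt_const
    (show (0 : ℝ≥0∞) < 2⁻¹ by simp)] with i hi x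
  obtain ⟨a, ha, b, hb, hab⟩ := exists_div_eq_mul_conj_of_measure_lt hi x
  exact hab ▸ hWU a ha b hb _ (hg x)

theorem tendsto_continuousMonoidHom_of_tendsto_measure [TopologicalSpace G] [CompactSpace G]
    [MeasurableSpace G] [MeasurableMul G] {μ : Measure G} [μ.IsMulLeftInvariant]
    [IsProbabilityMeasure μ] {l : Filter ι} {f : ι → G →ₜ* H} {g : G →ₜ* H}
    (hfg : ∀ A, IsOpen A → Tendsto (fun i => μ ((f i ⁻¹' A) ∆ (g ⁻¹' A))) l (𝓝 0)) :
    Tendsto f l (𝓝 g) := by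
  let _ := IsTopologicalGroup.rightUniformSpace H
  rw [(ContinuousMonoidHom.isInducing_toContinuousMap G H).tendsto_nhds_iff,
    ContinuousMap.tendsto_iff_tendstoUniformly, IsTopologicalGroup.tendstoUniformly_iff _ _ _ rfl]
  intro U hU
  exact eventually_forall_div_mem_of_tendsto_measure (f := fun i => (f i).toMonoidHom)
    (g := g.toMonoidHom) (isCompact_range g.continuous) (Set.mem_range_self (f := g)) hfg hU

end ConvergenceInMeasure

/-! ### Homeomorphism groups -/

section HomeomorphGroup

variable {X : Type u} [TopologicalSpace X]

/-- The map `f ↦ (f, f⁻¹)` that induces the topology of the homeomorphism group. -/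
def homeoPair (f : X ≃ₜ X) : C(X, X) × C(X, X) := (f, f.symm)

theorem isInducing_homeoPair : IsInducing (homeoPair (X := X)) := ⟨rfl⟩

theorem range_homeoPair : Set.range (homeoPair (X := X)) =
    {p | p.1.comp p.2 = ContinuousMap.id X ∧ p.2.comp p.1 = ContinuousMap.id X} := by
  refine Set.Subset.antisymm ?_ fun p hp => ?_
  · rintro _ ⟨f, rfl⟩
    exact ⟨ContinuousMap.ext f.apply_symm_apply, ContinuousMap.ext f.symm_apply_apply⟩
  · exact ⟨⟨⟨p.1, p.2, DFunLike.congr_fun hp.2, DFunLike.congr_fun hp.1⟩,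
      p.1.continuous, p.2.continuous⟩, rfl⟩

theorem isClosedEmbedding_homeoPair [LocallyCompactSpace X] [T2Space X] :
    IsClosedEmbedding (homeoPair (X := X)) where
  toIsInducing := isInducing_homeoPair
  injective f g hfg := Homeomorph.ext fun x => DFunLike.congr_fun (congrArg Prod.fst hfg) x
  isClosed_range := by
    rw [range_homeoPair]
    exact (isClosed_eq (continuous_fst.compCM continuous_snd) continuous_const).inter
      (isClosed_eq (continuous_snd.compCM continuous_fst) continuous_const)

instance homeo_isTopologicalGroup [LocallyCompactSpace X] : IsTopologicalGroup (X ≃ₜ X) where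
  continuous_mul := by
    have hpair := (isInducing_homeoPair (X := X)).continuous
    exact isInducing_homeoPair.continuous_iff.2 <|
      ((hpair.comp continuous_fst).fst.compCM (hpair.comp continuous_snd).fst).prodMk
        ((hpair.comp continuous_snd).snd.compCM (hpair.comp continuous_fst).snd)
  continuous_inv :=
    isInducing_homeoPair.continuous_iff.2 <|
      isInducing_homeoPair.continuous.snd.prodMk isInducing_homeoPair.continuous.fst

instance homeo_polishSpace [CompactSpace X] [TopologicalSpace.MetrizableSpace X] :
    PolishSpace (X ≃ₜ X) := by
  let _ := TopologicalSpace.metrizableSpaceMetric X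
  exact isClosedEmbedding_homeoPair.polishSpace

theorem continuous_homeo_apply (x : X) : Continuous fun f : X ≃ₜ X => f x :=
  (continuous_eval_const (F := C(X, X)) x).comp isInducing_homeoPair.continuous.fst

end HomeomorphGroup

namespace autGroup

variable {K : Type u} [Group K] [TopologicalSpace K]

theorem isClosed [ContinuousMul K] [T2Space K] : IsClosed (autGroup K : Set (K ≃ₜ K)) := by
  have coe_eq : (autGroup K : Set (K ≃ₜ K)) = ⋂ (x) (y), {f | f (x * y) = f x * f y} := by
    ext f
    simp only [Set.mem_iInter]
    rfl
  rw [coe_eq]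
  exact isClosed_iInter fun x => isClosed_iInter fun y => isClosed_eq
    (continuous_homeo_apply _) ((continuous_homeo_apply x).mul (continuous_homeo_apply y))

/-- An automorphism of a topological group as a continuous homomorphism. -/
def toContinuousMonoidHom (β : autGroup K) : K →ₜ* K :=
  ⟨MonoidHom.mk' β.1 β.2, β.1.continuous⟩

@[simp]
theorem coe_toContinuousMonoidHom (β : autGroup K) : ⇑(toContinuousMonoidHom β) = β.1 := rfl

theorem isInducing_toContinuousMonoidHom :
    IsInducing fun β : autGroup K => (toContinuousMonoidHom β, toContinuousMonoidHom β⁻¹) := by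
  have inducing_prodMap := (ContinuousMonoidHom.isInducing_toContinuousMap K K).prodMap
    (ContinuousMonoidHom.isInducing_toContinuousMap K K)
  exact inducing_prodMap.of_comp_iff.1 (isInducing_homeoPair.comp IsInducing.subtypeVal)

end autGroup

/-! ### The group `Aut_mp(X, μ)` -/

namespace AutMP

variable {X : Type u} [MeasurableSpace X] {μ : Measure X}

/-- The quotient homomorphism from measure preserving bijections to their classes. -/
def mkHom (μ : Measure X) : mpPerm μ →* AutMP μ := QuotientGroup.mk' (aeTrivial μ)

theorem mkHom_surjective : Function.Surjective (mkHom μ) :=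
  QuotientGroup.mk'_surjective (aeTrivial μ)

theorem mkHom_eq_iff {a b : mpPerm μ} : mkHom μ a = mkHom μ b ↔ ∀ᵐ x ∂μ, a.1 x = b.1 x := by
  refine QuotientGroup.eq.trans ?_
  change (∀ᵐ x ∂μ, a.1.symm (b.1 x) = x) ↔ _
  exact Filter.eventually_congr (.of_forall fun x => by rw [Equiv.symm_apply_eq, eq_comm])

theorem commute_mkHom_iff {a b : mpPerm μ} :
    Commute (mkHom μ a) (mkHom μ b) ↔ ∀ᵐ x ∂μ, a.1 (b.1 x) = b.1 (a.1 x) := by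
  rw [commute_iff_eq, ← map_mul, ← map_mul, mkHom_eq_iff]
  rfl

theorem continuous_dist {A B : Set X} (hA : MeasurableSet A) (hB : MeasurableSet B) :
    Continuous (AutMP.dist A B : AutMP μ → ℝ≥0∞) :=
  continuous_iff_le_induced.2 (iInf₂_le_of_le ⟨A, hA⟩ ⟨B, hB⟩ le_rfl)

theorem continuous_iff_dist {Y : Type*} [TopologicalSpace Y] {f : Y → AutMP μ} :
    Continuous f ↔ ∀ A B, MeasurableSet A → MeasurableSet B →
      Continuous fun y => AutMP.dist A B (f y) := by
  simp only [continuous_iInf_rng, continuous_induced_rng, Subtype.forall]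
  exact forall_congr' fun _ => forall_comm

theorem dist_inv {A B : Set X} (hA : MeasurableSet A) (hB : MeasurableSet B) (T : AutMP μ) :
    AutMP.dist A B T⁻¹ = AutMP.dist B A T := by
  obtain ⟨t, rfl⟩ := mkHom_surjective T
  change μ ((t.1.symm ⁻¹' A) ∆ B) = μ ((t.1 ⁻¹' B) ∆ A)
  rw [← t.2.1.measure_preimage ((t.2.2.measurable hA).symmDiff hB).nullMeasurableSet,
    Set.preimage_symmDiff, ← Set.preimage_comp, Equiv.symm_comp_self, Set.preimage_id,
    symmDiff_comm]

instance instContinuousInv : ContinuousInv (AutMP μ) where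
  continuous_inv := continuous_iff_dist.2 fun A B hA hB => by
    simpa only [dist_inv hA hB] using continuous_dist hB hA

theorem continuous_mkHom [TopologicalSpace X] [R1Space X] [BorelSpace X] [IsFiniteMeasure μ]
    [μ.InnerRegularCompactLTTop] {Y : Type*} [TopologicalSpace Y] {Φ : Y → C(X, X)}
    (hΦ : Continuous Φ) {e : Y → mpPerm μ} (he : ∀ y, ⇑(e y).1 = Φ y) :
    Continuous fun y => mkHom μ (e y) := by
  refine continuous_iff_dist.2 fun A B hA hB => ?_
  have mp (y : Y) : MeasurePreserving (Φ y) μ μ := he y ▸ (e y).2.1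
  let preimage (y : Y) : MeasuredSets μ := ⟨Φ y ⁻¹' A, (mp y).measurable hA⟩
  have continuous_preimage : Continuous preimage := continuous_iff_continuousAt.2 fun y =>
    tendsto_iff_edist_tendsto_0.2 <| tendsto_measure_symmDiff_preimage_nhds_zero
      (hΦ.tendsto y) (.of_forall mp) (mp y) hA.nullMeasurableSet (measure_ne_top μ A)
  let target : MeasuredSets μ := ⟨B, hB⟩
  refine (continuous_preimage.edist (continuous_const (y := target))).congr fun y => ?_
  change μ ((Φ y ⁻¹' A) ∆ B) = μ (((e y).1 ⁻¹' A) ∆ B)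
  rw [he]

end AutMP

/-! ### The diagonal embedding of `Aut K` -/

/-- A measure preserving isomorphism as an element of the group `mpPerm μ`. -/
def mpPerm.ofMeasurableEquiv {X : Type u} [MeasurableSpace X] {μ : Measure X} (e : X ≃ᵐ X)
    (he : MeasurePreserving e μ μ) : mpPerm μ := ⟨e.toEquiv, he, he.symm e⟩

theorem dist_diag {X : Type u} [MeasurableSpace X] {m : Measure X} [IsProbabilityMeasure m]
    (α : X ≃ᵐ X) (hα : MeasurePreserving α m m) (n : ℕ) {A B : Set X} (hA : MeasurableSet A)
    (hB : MeasurableSet B) :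
    AutMP.dist ((fun x => x n) ⁻¹' A) ((fun x => x n) ⁻¹' B) (diag α hα) = m ((α ⁻¹' A) ∆ B) :=
  (measurePreserving_eval_infinitePi (fun _ => m) n).measure_preimage
    ((α.measurable hA).symmDiff hB).nullMeasurableSet

/-- The diagonal map `x ↦ (β (x n))_n` given by a continuous map `β`. -/
def diagContinuousMap {X : Type*} [TopologicalSpace X] (β : C(X, X)) : C(ℕ → X, ℕ → X) :=
  ⟨fun x n => β (x n), by fun_prop⟩

theorem continuous_diagContinuousMap {X : Type*} [TopologicalSpace X] [LocallyCompactSpace X] :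
    Continuous (diagContinuousMap (X := X)) := by
  refine ContinuousMap.continuous_of_continuous_uncurry _ ?_
  change Continuous fun p : C(X, X) × (ℕ → X) => fun n => p.1 (p.2 n)
  fun_prop

section DiagonalEmbedding

variable {K : Type u} [Group K] [TopologicalSpace K] [IsTopologicalGroup K] [CompactSpace K]
  [MeasurableSpace K] [BorelSpace K] (m : Measure K) [m.IsHaarMeasure] [IsProbabilityMeasure m]

/-- The homomorphism `β ↦ φ_β`. -/
noncomputable def autDiagHom : autGroup K →* AutMP (powMeasure m) :=
  MonoidHom.mk' (autDiag m) fun _ _ => rfl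

theorem commute_coordPerm_autDiagHom (σ : Equiv.Perm ℕ) (β : autGroup K) :
    Commute (coordPerm m σ) (autDiagHom m β) := rfl

theorem tendsto_toContinuousMonoidHom_of_tendsto_autDiagHom {ι : Type*} {l : Filter ι}
    {f : ι → autGroup K} {β : autGroup K}
    (hf : Tendsto (fun i => autDiagHom m (f i)) l (𝓝 (autDiagHom m β))) :
    Tendsto (fun i => autGroup.toContinuousMonoidHom (f i)) l
      (𝓝 (autGroup.toContinuousMonoidHom β)) := by
  refine tendsto_continuousMonoidHom_of_tendsto_measure (μ := m) fun A hA => ?_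
  have measurable_preimage : MeasurableSet (β.1 ⁻¹' A) := (hA.preimage β.1.continuous).measurableSet
  have measurable_eval : Measurable fun x : ℕ → K => x 0 := measurable_pi_apply 0
  have dist_eq (γ : autGroup K) :
      AutMP.dist ((fun x => x 0) ⁻¹' A) ((fun x => x 0) ⁻¹' (β.1 ⁻¹' A)) (autDiagHom m γ) =
        m ((γ.1 ⁻¹' A) ∆ (β.1 ⁻¹' A)) :=
    dist_diag _ (autGroup_mp m γ) 0 hA.measurableSet measurable_preimage
  have tendsto_dist := ((AutMP.continuous_dist (measurable_eval hA.measurableSet)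
    (measurable_eval measurable_preimage)).tendsto _).comp hf
  simpa [Function.comp_def, dist_eq] using tendsto_dist

variable [SecondCountableTopology K]

theorem commute_mulFirst_autDiagHom (β : autGroup K) :
    Commute (mulFirst m) (autDiagHom m β) := by
  refine AutMP.commute_mkHom_iff.2 (.of_forall fun x => funext fun n => ?_)
  change (if n = 0 then β.1 (x 0) * β.1 (x 1) else β.1 (x n)) =
    β.1 (if n = 0 then x 0 * x 1 else x n)
  rw [apply_ite β.1, β.2]

variable [T2Space K]

theorem continuous_autDiagHom : Continuous (autDiagHom m) := by
  have continuous_coe : Continuous fun β : autGroup K => (β.1 : C(K, K)) :=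
    isInducing_homeoPair.continuous.fst.comp continuous_subtype_val
  exact AutMP.continuous_mkHom (continuous_diagContinuousMap.comp continuous_coe)
    (e := fun β => mpPerm.ofMeasurableEquiv _ (diag_mp _ (autGroup_mp m β))) fun _ => rfl

theorem isEmbedding_autDiagHom : IsEmbedding (autDiagHom m) := by
  refine (isInducing_iff_nhds.2 fun β => le_antisymm
    (continuous_autDiagHom m).continuousAt.le_comap ?_).isEmbedding
  refine tendsto_id'.1 (autGroup.isInducing_toContinuousMonoidHom.tendsto_nhds_iff.2
    (Tendsto.prodMk_nhds ?_ ?_))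
  · exact tendsto_toContinuousMonoidHom_of_tendsto_autDiagHom m tendsto_comap
  · refine tendsto_toContinuousMonoidHom_of_tendsto_autDiagHom m ?_
    simpa only [map_inv, id] using tendsto_comap.inv

end DiagonalEmbedding

/-! ### The centralizer of the transpositions and `θ` -/

theorem exists_measurable_ae_eq_diagonal_of_commute_swap {X : Type*} [MeasurableSpace X]
    [MeasurableSpace.CountablySeparated X] (m : Measure X)
    [IsProbabilityMeasure m] {T : (ℕ → X) → ℕ → X} (hT : Measurable T)
    (hswap : ∀ i j : ℕ, ∀ᵐ x ∂powMeasure m, T (x ∘ Equiv.swap i j) = T x ∘ Equiv.swap i j) :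
    ∃ α : X → X, Measurable α ∧ ∀ᵐ x ∂powMeasure m, ∀ n, T x n = α (x n) := by
  obtain ⟨α, hα, eval_zero⟩ := exists_measurable_ae_eq_comp_eval_zero_of_swap_invariant m
    (F := fun x => T x 0) (by fun_prop) fun i j hi hj => by
      filter_upwards [hswap i j] with x hx
      rw [hx, Function.comp_apply, Equiv.swap_apply_of_ne_of_ne hi.symm hj.symm]
  refine ⟨α, hα, ae_all_iff.2 fun n => ?_⟩
  filter_upwards [hswap 0 n, (measurePreserving_reindex_infinitePi (fun _ => m)
    (Equiv.swap 0 n).injective).quasiMeasurePreserving.ae eval_zero] with x hx hx_zero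
  simpa using (congrFun hx 0).symm.trans hx_zero

theorem leftInverse_of_ae_eq_diagonal {X : Type*} [TopologicalSpace X] [T2Space X]
    [SecondCountableTopology X] [MeasurableSpace X] [BorelSpace X] (m : Measure X)
    [IsProbabilityMeasure m] [m.IsOpenPosMeasure] {S T : (ℕ → X) → ℕ → X} {β γ : X → X}
    (hβ : Continuous β) (hγ : Continuous γ)
    (hT : MeasurePreserving T (powMeasure m) (powMeasure m)) (hST : Function.LeftInverse S T)
    (hSβ : ∀ᵐ x ∂powMeasure m, ∀ n, S x n = β (x n))
    (hTγ : ∀ᵐ x ∂powMeasure m, ∀ n, T x n = γ (x n)) : Function.LeftInverse β γ := by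
  have ae_eq_id : ∀ᵐ k ∂m, β (γ k) = k := by
    refine ae_eq_of_ae_eq_comp_measurePreserving
      (measurePreserving_eval_infinitePi (fun _ : ℕ => m) 0) (hβ.comp hγ).measurable
      measurable_id ?_
    filter_upwards [hTγ, hT.quasiMeasurePreserving.ae hSβ] with x hx hTx
    calc β (γ (x 0)) = S (T x) 0 := by rw [hTx, hx]
      _ = x 0 := by rw [hST]
  exact congrFun ((Continuous.ae_eq_iff_eq m (hβ.comp hγ) continuous_id).1 ae_eq_id)

section Centralizer

variable {K : Type u} [Group K] [TopologicalSpace K] [IsTopologicalGroup K] [CompactSpace K]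
  [T2Space K] [SecondCountableTopology K] [MeasurableSpace K] [BorelSpace K]
  (m : Measure K) [m.IsHaarMeasure] [IsProbabilityMeasure m]

theorem ae_ae_map_mul_of_commute_mulFirst {T : (ℕ → K) → ℕ → K} {α : K → K} (hα : Measurable α)
    (hTα : ∀ᵐ x ∂powMeasure m, ∀ n, T x n = α (x n))
    (hθ : ∀ᵐ x ∂powMeasure m, T (mulFirstEquiv K x) = mulFirstEquiv K (T x)) :
    ∀ᵐ x ∂m, ∀ᵐ y ∂m, α (x * y) = α x * α y := by
  refine Measure.ae_ae_of_ae_prod (ae_eq_of_ae_eq_comp_measurePreserving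
    (measurePreserving_eval_pair_infinitePi (fun _ : ℕ => m) zero_ne_one)
    (u := fun p => α (p.1 * p.2)) (v := fun p => α p.1 * α p.2) (by fun_prop) (by fun_prop) ?_)
  filter_upwards [hθ, hTα, (mulFirst_mp m).quasiMeasurePreserving.ae hTα] with x hx hTx hTθx
  simpa [mulFirstEquiv, hTx] using ((congrFun hx 0).symm.trans (hTθx 0)).symm

theorem exists_continuousMonoidHom_ae_eq_diagonal {T : (ℕ → K) → ℕ → K} (hT : Measurable T)
    (hswap : ∀ i j : ℕ, ∀ᵐ x ∂powMeasure m, T (x ∘ Equiv.swap i j) = T x ∘ Equiv.swap i j)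
    (hθ : ∀ᵐ x ∂powMeasure m, T (mulFirstEquiv K x) = mulFirstEquiv K (T x)) :
    ∃ β : K →ₜ* K, ∀ᵐ x ∂powMeasure m, ∀ n, T x n = β (x n) := by
  obtain ⟨α, hα, hTα⟩ := exists_measurable_ae_eq_diagonal_of_commute_swap m hT hswap
  obtain ⟨β, hαβ⟩ := exists_monoidHom_ae_eq (ae_ae_map_mul_of_commute_mulFirst m hα hTα hθ)
  refine ⟨⟨β, continuous_monoidHom_of_aemeasurable (μ := m) β (hα.aemeasurable.congr hαβ)⟩, ?_⟩
  have hαβ_coord : ∀ᵐ x ∂powMeasure m, ∀ n, α (x n) = β (x n) := ae_all_iff.2 fun n =>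
    (measurePreserving_eval_infinitePi (fun _ => m) n).quasiMeasurePreserving.ae hαβ
  filter_upwards [hTα, hαβ_coord] with x hx hαβx n
  exact (hx n).trans (hαβx n)

theorem mem_range_autDiagHom_of_commute {T : AutMP (powMeasure m)}
    (hswap : ∀ i j : ℕ, Commute T (coordPerm m (Equiv.swap i j)))
    (hθ : Commute T (mulFirst m)) : T ∈ (autDiagHom m).range := by
  obtain ⟨t, rfl⟩ := AutMP.mkHom_surjective T
  have exists_diagonal (s : mpPerm (powMeasure m))
      (hswap : ∀ i j : ℕ, Commute (AutMP.mkHom _ s) (coordPerm m (Equiv.swap i j)))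
      (hθ : Commute (AutMP.mkHom _ s) (mulFirst m)) :
      ∃ β : K →ₜ* K, ∀ᵐ x ∂powMeasure m, ∀ n, s.1 x n = β (x n) :=
    exists_continuousMonoidHom_ae_eq_diagonal m s.2.1.measurable
      (fun i j => AutMP.commute_mkHom_iff.1 (hswap i j)) (AutMP.commute_mkHom_iff.1 hθ)
  obtain ⟨β, hβ⟩ := exists_diagonal t hswap hθ
  obtain ⟨γ, hγ⟩ := exists_diagonal t⁻¹
    (fun i j => map_inv (AutMP.mkHom _) t ▸ (hswap i j).inv_left)
    (map_inv (AutMP.mkHom _) t ▸ hθ.inv_left)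
  let b : K ≃ₜ K :=
    { toFun := β
      invFun := γ
      left_inv := leftInverse_of_ae_eq_diagonal m γ.continuous β.continuous t.2.1
        t.1.symm_apply_apply hγ hβ
      right_inv := leftInverse_of_ae_eq_diagonal m β.continuous γ.continuous t.2.2
        t.1.apply_symm_apply hβ hγ
      continuous_toFun := β.continuous
      continuous_invFun := γ.continuous }
  refine ⟨⟨b, map_mul β⟩, AutMP.mkHom_eq_iff.2 ?_⟩
  filter_upwards [hβ] with x hx
  exact funext fun n => (hx n).symm

theorem centralizer_eq_range_autDiagHom {S : Set (AutMP (powMeasure m))}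
    (hswap : ∀ i j : ℕ, coordPerm m (Equiv.swap i j) ∈ S) (hθ : mulFirst m ∈ S)
    (hS : S ⊆ permMulGroup m) : Subgroup.centralizer S = (autDiagHom m).range := by
  refine le_antisymm (fun T hT => ?_) ?_
  · rw [Subgroup.mem_centralizer_iff] at hT
    exact mem_range_autDiagHom_of_commute m (fun i j => (hT _ (hswap i j)).symm) (hT _ hθ).symm
  · refine le_trans ?_ (Subgroup.centralizer_le hS)
    rw [permMulGroup, Subgroup.centralizer_closure]
    rintro _ ⟨β, rfl⟩
    rw [Subgroup.mem_centralizer_iff]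
    rintro _ (⟨σ, rfl⟩ | rfl)
    · exact commute_coordPerm_autDiagHom m σ β
    · exact commute_mulFirst_autDiagHom m β

end Centralizer

/-- An embedding of topological groups as an isomorphism onto its range. -/
noncomputable def continuousMulEquivRange {G H : Type*} [Group G] [TopologicalSpace G] [Group H]
    [TopologicalSpace H] (f : G →* H) (hf : IsEmbedding f) : G ≃ₜ* f.range :=
  .mk' hf.toHomeomorph fun x y => Subtype.ext (map_mul f x y)

theorem countable_closure {G : Type*} [Group G] {s : Set G} (hs : s.Countable) :
    Countable (Subgroup.closure s) := by
  have : Countable s := hs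
  have : Countable (FreeGroup s) := inferInstanceAs (Countable (Quot _))
  rw [FreeGroup.closure_eq_range]
  exact (FreeGroup.lift ((↑) : s → G)).rangeRestrict_surjective.countable

/-! ### A countable ergodic group with the same centralizer -/

section SwapMulGroup

variable {K : Type u} [Group K] [MeasurableSpace K] [MeasurableMul₂ K] [MeasurableInv K]
  (m : Measure K) [IsProbabilityMeasure m] [m.IsMulRightInvariant]

/-- The group of bijections of `K ^ ℕ` generated by the transpositions of coordinates and `θ`. It
replaces the uncountable group `permMulGroup m` where the acting group must be countable. -/
noncomputable def swapMulGroup : Subgroup (mpPerm (powMeasure m)) :=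
  Subgroup.closure
    (Set.range (fun p : ℕ × ℕ => mpPerm.ofMeasurableEquiv _ (coordPerm_mp m (.swap p.1 p.2))) ∪
      {mpPerm.ofMeasurableEquiv _ (mulFirst_mp m)})

theorem swap_mem_swapMulGroup (i j : ℕ) :
    mpPerm.ofMeasurableEquiv _ (coordPerm_mp m (.swap i j)) ∈ swapMulGroup m :=
  Subgroup.subset_closure (Or.inl ⟨(i, j), rfl⟩)

theorem mulFirst_mem_swapMulGroup :
    mpPerm.ofMeasurableEquiv _ (mulFirst_mp m) ∈ swapMulGroup m :=
  Subgroup.subset_closure (Or.inr rfl)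

theorem swapMulGroup_le_comap_permMulGroup :
    swapMulGroup m ≤ (permMulGroup m).comap (AutMP.mkHom (powMeasure m)) := by
  refine (Subgroup.closure_le _).2 ?_
  rintro _ (⟨p, rfl⟩ | rfl)
  · exact Subgroup.subset_closure (Or.inl ⟨_, rfl⟩)
  · exact Subgroup.subset_closure (Or.inr rfl)

instance countable_swapMulGroup : Countable (swapMulGroup m) :=
  countable_closure ((Set.countable_range _).union (Set.countable_singleton _))

instance measurableConstSMul_swapMulGroup : MeasurableConstSMul (swapMulGroup m) (ℕ → K) :=
  ⟨fun g => g.1.2.1.measurable⟩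

instance ergodicSMul_swapMulGroup : ErgodicSMul (swapMulGroup m) (ℕ → K) (powMeasure m) where
  measure_preimage_smul g _ hs := g.1.2.1.measure_preimage hs.nullMeasurableSet
  aeconst_of_forall_preimage_smul_ae_eq hs hinv :=
    eventuallyConst_of_swap_invariant m hs fun i j => hinv ⟨_, swap_mem_swapMulGroup m i j⟩

end SwapMulGroup

theorem isCentralizerGroup_autGroup {K : Type u} [Group K] [TopologicalSpace K]
    [IsTopologicalGroup K] [CompactSpace K] [T2Space K] [SecondCountableTopology K]
    [MeasurableSpace K] [BorelSpace K] (m : Measure K) [m.IsHaarMeasure]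
    [IsProbabilityMeasure m] : IsCentralizerGroup (autGroup K) := by
  let _ := TopologicalSpace.metrizableSpaceMetric K
  have centralizer_eq :
      Subgroup.centralizer (Set.range (AutMP.ofSMul (Λ := swapMulGroup m) (powMeasure m))) =
        (autDiagHom m).range :=
    centralizer_eq_range_autDiagHom m (fun i j => ⟨⟨_, swap_mem_swapMulGroup m i j⟩, rfl⟩)
      ⟨⟨_, mulFirst_mem_swapMulGroup m⟩, rfl⟩
      (Set.range_subset_iff.2 fun g => swapMulGroup_le_comap_permMulGroup m g.2)
  refine ⟨inferInstance, autGroup.isClosed.polishSpace, ℕ → K, inferInstance, inferInstance,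
    powMeasure m, inferInstance, swapMulGroup m, inferInstance, inferInstance, inferInstance,
    inferInstance, inferInstance, ?_⟩
  rw [centralizer_eq]
  exact ⟨continuousMulEquivRange _ (isEmbedding_autDiagHom m)⟩

end

theorem mainTheorem4 {K : Type*} [Group K] [TopologicalSpace K] [IsTopologicalGroup K]
    [CompactSpace K] [T2Space K] [SecondCountableTopology K] [MeasurableSpace K] [BorelSpace K]
    (m : Measure K) [m.IsHaarMeasure] [IsProbabilityMeasure m] :
    IsCentralizerGroup (autGroup K) ∧
    ∃ e : autGroup K ≃ₜ* Subgroup.centralizer (permMulGroup m : Set (AutMP (powMeasure m))),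
      ∀ β : autGroup K, (e β : AutMP (powMeasure m)) = autDiag m β := by
  refine ⟨isCentralizerGroup_autGroup m, ?_⟩
  have centralizer_eq :
      Subgroup.centralizer (permMulGroup m : Set (AutMP (powMeasure m))) = (autDiagHom m).range :=
    centralizer_eq_range_autDiagHom m (fun _ _ => Subgroup.subset_closure (Or.inl ⟨_, rfl⟩))
      (Subgroup.subset_closure (Or.inr rfl)) subset_rfl
  rw [centralizer_eq]
  exact ⟨continuousMulEquivRange _ (isEmbedding_autDiagHom m), fun _ => rfl⟩
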